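/- Let $n=14$. A boolean function $f(x_1,\dots,x_n)$ is regarded as a map $f$ from the subsets of $\{1,\dots,n\}$ to $\{0,1\}$, an input being identified with the set of indices $i$ for which $x_i=1$. It is monotone non-increasing if $f(A)=1$ and $B\subseteq A$ imply $f(B)=1$; it is nontrivial if it is not constant; and it is invariant under a group $G$ of permutations of $\{1,\dots,n\}$ if $f(A)=f(\sigma(A))$ for every $\sigma\in G$ and every $A\subseteq\{1,\dots,n\}$. A decision tree of $f$ is a binary tree with inner nodes labelled by variables and leaves labelled by $0$ or $1$, in which every variable appears at most once on each root-leaf path, and such that for every input, starting at the root and moving at each inner node to the left or the right child according as the variable there has value $1$ or $0$, one ends at a leaf labelled by the value of $f$. Let $D(f)$ be the minimum, over all decision trees of $f$, of the depth (the maximum number of inner nodes on a root-leaf path). The function $f$ is elusive if $D(f)=n$. Let $G_1$ be the cyclic group of order $14$ generated by the $14$-cycle $(1,2,\dots,14)$. Then every nontrivial monotone non-increasing $G_1$-invariant boolean function $f(x_1,\dots,x_{14})$ is elusive. -/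

import Mathlib

namespace Elusive

/-- A boolean function of `n` variables. An input is the set of the variables that have value `1`. -/
abbrev BoolFun (n : ℕ) : Type := Finset (Fin n) → Bool

/-- Binary trees whose inner nodes are labelled by variables and whose leaves are labelled by
`0` or `1`. The left child of a node is reached when its variable is `1`, the right child when it
is `0`. -/
inductive DecisionTree (n : ℕ) : Type
  | leaf (b : Bool) : DecisionTree n
  | node (i : Fin n) (left right : DecisionTree n) : DecisionTree n

namespace DecisionTree

variable {n : ℕ}

/-- The label of the leaf that is reached on input `x`. -/
def eval : DecisionTree n → Finset (Fin n) → Bool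
  | leaf b, _ => b
  | node i l r, x => if i ∈ x then l.eval x else r.eval x

/-- The maximum number of inner nodes (equivalently, of edges) on a root-leaf path. -/
def depth : DecisionTree n → ℕ
  | leaf _ => 0
  | node _ l r => max l.depth r.depth + 1

/-- The variables that label some inner node. -/
def vars : DecisionTree n → Finset (Fin n)
  | leaf _ => ∅
  | node i l r => insert i (l.vars ∪ r.vars)

/-- On every root-leaf path each variable appears at most once. -/
def ReadOnce : DecisionTree n → Prop
  | leaf _ => True
  | node i l r => i ∉ l.vars ∧ i ∉ r.vars ∧ l.ReadOnce ∧ r.ReadOnce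

/-- `T` is a decision tree of the boolean function `f`. -/
def IsTreeOf (T : DecisionTree n) (f : BoolFun n) : Prop :=
  T.ReadOnce ∧ ∀ x, T.eval x = f x

end DecisionTree

/-- `D(f)`, the minimum depth among all decision trees of `f`. -/
noncomputable def D {n : ℕ} (f : BoolFun n) : ℕ :=
  sInf {d | ∃ T : DecisionTree n, T.IsTreeOf f ∧ T.depth = d}

/-- `f` is elusive if `D(f)` is the number of its variables. -/
def IsElusive {n : ℕ} (f : BoolFun n) : Prop :=
  D f = n

/-- `f` is nontrivial if it is not constant. -/
def Nontrivial {n : ℕ} (f : BoolFun n) : Prop :=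
  ¬ ∃ b : Bool, ∀ x, f x = b

/-- `f` is monotone non-increasing: subsets of true inputs are true inputs. -/
def MonotoneNonincreasing {n : ℕ} (f : BoolFun n) : Prop :=
  ∀ x y : Finset (Fin n), y ⊆ x → f x = true → f y = true

/-- `f` is `G`-invariant: `f(x) = f(σ(x))` for all `σ ∈ G` and all inputs `x`. -/
def IsInvariant {n : ℕ} (G : Subgroup (Equiv.Perm (Fin n))) (f : BoolFun n) : Prop :=
  ∀ σ ∈ G, ∀ x : Finset (Fin n), f x = f (x.map σ.toEmbedding)

/-- The group generated by the 14-cycle `(1, 2, …, 14)`; the variables are numbered from `0`,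
so the generator is `(0, 1, …, 13)`. -/
def G₁ : Subgroup (Equiv.Perm (Fin 14)) :=
  Subgroup.zpowers (finRotate 14)

end Elusive

/-!
A decision tree of depth less than `n` splits the simplicial complex of true inputs into subcubes of
positive dimension. The chains supported on one subcube are contractible, and contracting homotopies
can be glued along the tree, so the augmented chain complex of the whole complex is contractible.
By the Hopf trace formula modulo `2`, an automorphism of the complex then fixes an even number of
faces, the empty face included. But an `n`-cycle leaves only the empty and the full set invariant,
and of these two only the empty set is a true input.
-/

namespace Elusive

open Finset Matrix

section Contraction

variable {ι κ R : Type*} [Fintype ι] [DecidableEq ι] [Fintype κ] [DecidableEq κ] [Ring R]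

/-- The square matrix `d`, thought of as the differential of a chain complex, admits a contracting
homotopy. For a differential over a field this says that the complex is acyclic. -/
def HasContraction (d : Matrix ι ι R) : Prop :=
  ∃ h : Matrix ι ι R, d * h + h * d = 1

theorem hasContraction_of_isEmpty [IsEmpty ι] (d : Matrix ι ι R) : HasContraction d :=
  ⟨0, Subsingleton.elim _ _⟩

theorem HasContraction.submatrix {d : Matrix ι ι R} (hd : HasContraction d) (e : κ ≃ ι) :
    HasContraction (d.submatrix e e) := by
  obtain ⟨h, hh⟩ := hd
  refine ⟨h.submatrix e e, ?_⟩
  rw [submatrix_mul_equiv, submatrix_mul_equiv, ← submatrix_one_equiv e, ← hh]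
  rfl

theorem HasContraction.fromBlocks {d₁ : Matrix ι ι R} {d₂ : Matrix κ κ R} {b : Matrix κ ι R}
    (h₁ : HasContraction d₁) (h₂ : HasContraction d₂) (hb : b * d₁ + d₂ * b = 0) :
    HasContraction (Matrix.fromBlocks d₁ 0 b d₂) := by
  obtain ⟨h, hh⟩ := h₁
  obtain ⟨k, hk⟩ := h₂
  have corner : b * h - d₂ * (k * b * h) + (k * b - k * b * h * d₁) = 0 :=
    calc b * h - d₂ * (k * b * h) + (k * b - k * b * h * d₁)
      _ = (1 - d₂ * k) * (b * h) + k * b * (1 - h * d₁) := by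
        simp only [Matrix.sub_mul, Matrix.mul_sub, Matrix.one_mul, Matrix.mul_one,
          Matrix.mul_assoc]
      _ = k * d₂ * (b * h) + k * b * (d₁ * h) := by
        rw [← eq_sub_of_add_eq' hk, ← eq_sub_of_add_eq hh]
      _ = k * (b * d₁ + d₂ * b) * h := by
        simp only [Matrix.add_mul, Matrix.mul_add, Matrix.mul_assoc, add_comm]
      _ = 0 := by rw [hb, Matrix.mul_zero, Matrix.zero_mul]
  refine ⟨Matrix.fromBlocks h 0 (-(k * b * h)) k, ?_⟩
  simp only [fromBlocks_multiply, fromBlocks_add, Matrix.mul_zero, Matrix.zero_mul, Matrix.mul_neg,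
    Matrix.neg_mul, add_zero, zero_add, sub_zero, ← sub_eq_add_neg, neg_add_eq_sub, hh, hk, corner,
    fromBlocks_one]

/-- The Hopf trace formula: as `σ` commutes with `d`, the contraction `h` gives
`tr σ = tr (σ d h) + tr (σ h d) = 2 tr (σ d h)`. -/
theorem HasContraction.even_ncard_fixedPoints {d : Matrix ι ι (ZMod 2)} (hd : HasContraction d)
    (σ : Equiv.Perm ι) (hσ : d.submatrix σ σ = d) : Even (Function.fixedPoints σ).ncard := by
  obtain ⟨h, hh⟩ := hd
  set S := σ.permMatrix (ZMod 2)
  have commute : S * d = d * S := by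
    rw [PEquiv.toMatrix_toPEquiv_mul, PEquiv.mul_toMatrix_toPEquiv]
    nth_rw 2 [← hσ]
    simp
  have trace_eq : (S * (h * d)).trace = (S * (d * h)).trace := by
    rw [← mul_assoc, trace_mul_comm, ← mul_assoc, ← commute, mul_assoc]
  rw [← ZMod.natCast_eq_zero_iff_even, ← trace_permutation, ← mul_one (σ.permMatrix _), ← hh,
    mul_add, trace_add, trace_eq]
  exact CharTwo.add_self_eq_zero _

end Contraction

section Boundary

variable {β : Type*} [PartialOrder β]

open Classical in
/-- The incidence matrix of the covering relation of the finite family `X`, modulo `2`. When `X`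
consists of finite sets this is the boundary matrix of simplicial chains (the empty face included),
restricted to the faces in `X`: the column of a face marks its facets. -/
noncomputable def boundary (X : Finset β) : Matrix X X (ZMod 2) :=
  Matrix.of fun B A => if (B : β) ⋖ A then 1 else 0

variable [DecidableEq β]

theorem hasContraction_boundary_union {X Y : Finset β} (hXY : ∀ B ∈ X, ∀ A ∈ Y, ¬ B ≤ A)
    (hsq : boundary (X ∪ Y) * boundary (X ∪ Y) = 0)
    (hX : HasContraction (boundary X)) (hY : HasContraction (boundary Y)) :
    HasContraction (boundary (X ∪ Y)) := by
  have hdisj : Disjoint X Y := disjoint_left.2 fun A hAX hAY => hXY A hAX A hAY le_rfl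
  set e := Equiv.Finset.union X Y hdisj
  set b := ((boundary (X ∪ Y)).submatrix e e).toBlocks₂₁
  have blocks : (boundary (X ∪ Y)).submatrix e e =
      fromBlocks (boundary X) 0 b (boundary Y) := by
    rw [← fromBlocks_toBlocks ((boundary (X ∪ Y)).submatrix e e)]
    congr 1
    ext B A
    exact if_neg fun h => hXY B B.2 A A.2 h.le
  have hb : b * boundary X + boundary Y * b = 0 := by
    have := congrArg (fun M => M.submatrix e e) hsq
    rw [← submatrix_mul_equiv _ _ _ e, blocks, fromBlocks_multiply] at this
    exact congrArg toBlocks₂₁ this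
  simpa [← blocks] using (hX.fromBlocks hY hb).submatrix e.symm

theorem hasContraction_boundary_pair {P Q : β} (hPQ : P ⋖ Q) :
    HasContraction (boundary {P, Q}) := by
  classical
  have hPQne : P ≠ Q := hPQ.ne
  refine ⟨(boundary {P, Q})ᵀ, ?_⟩
  ext ⟨B, hB⟩ ⟨A, hA⟩
  simp only [Matrix.add_apply, mul_apply, transpose_apply, boundary, of_apply, univ_eq_attach]
  rw [sum_attach {P, Q} fun C => (if B ⋖ C then (1 : ZMod 2) else 0) * if A ⋖ C then 1 else 0,
    sum_attach {P, Q} fun C => (if C ⋖ B then (1 : ZMod 2) else 0) * if C ⋖ A then 1 else 0,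
    sum_pair hPQne, sum_pair hPQne]
  simp only [mem_insert, mem_singleton] at hA hB
  have hQP : ¬ Q ⋖ P := fun h => hPQ.lt.asymm h.lt
  obtain rfl | rfl := hB <;> obtain rfl | rfl := hA <;>
    simp [hPQ, hQP, hPQne, hPQne.symm]

theorem even_card_fixed_of_hasContraction {X : Finset β} (hX : HasContraction (boundary X))
    (σ : β ≃o β) (hσ : ∀ A, σ A ∈ X ↔ A ∈ X) : Even #{A ∈ X | σ A = A} := by
  let τ : Equiv.Perm X := Equiv.Perm.subtypePerm σ.toEquiv hσ
  have hτ : (boundary X).submatrix τ τ = boundary X := by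
    classical
    ext B A
    exact if_congr (apply_covBy_apply_iff σ) rfl rfl
  have hfixed : Subtype.val '' Function.fixedPoints τ = ↑{A ∈ X | σ A = A} := by
    ext A
    simp [τ, Function.IsFixedPt, Subtype.ext_iff, and_comm]
  rw [← Set.ncard_coe_finset, ← hfixed, Set.ncard_image_of_injective _ Subtype.val_injective]
  exact hX.even_ncard_fixedPoints τ hτ

end Boundary

section SetFamilies

variable {α : Type*}

theorem even_card_covBy_covBy {X : Finset (Finset α)} (hX : (X : Set (Finset α)).OrdConnected)
    {A B : Finset α} (hA : A ∈ X) (hB : B ∈ X) [DecidablePred fun C => B ⋖ C ∧ C ⋖ A] :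
    Even #{C ∈ X | B ⋖ C ∧ C ⋖ A} := by
  classical
  obtain hempty | ⟨C₀, hC₀⟩ := Finset.eq_empty_or_nonempty {C ∈ X | B ⋖ C ∧ C ⋖ A}
  · simp [hempty]
  obtain ⟨-, hBC₀, hC₀A⟩ := mem_filter.1 hC₀
  obtain ⟨a, haB, rfl⟩ := hBC₀.exists_finset_insert
  obtain ⟨b, hb, rfl⟩ := hC₀A.exists_finset_insert
  obtain ⟨hba, hbB⟩ := not_or.1 (mem_insert.not.1 hb)
  have covBy_a : B ⋖ insert a B := covBy_insert haB
  have covBy_b : B ⋖ insert b B := covBy_insert hbB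
  have covBy_ab : insert b B ⋖ insert b (insert a B) := by
    rw [insert_comm]
    exact covBy_insert (by simp [haB, Ne.symm hba])
  have filter_eq :
      {C ∈ X | B ⋖ C ∧ C ⋖ insert b (insert a B)} = {insert a B, insert b B} := by
    ext C
    simp only [mem_filter, mem_insert, mem_singleton]
    constructor
    · rintro ⟨-, hBC, hCA⟩
      obtain ⟨c, hcB, rfl⟩ := hBC.exists_finset_insert
      have hc := hCA.le (mem_insert_self c B)
      simp only [mem_insert, hcB, or_false] at hc
      exact hc.symm.imp (congrArg (insert · B)) (congrArg (insert · B))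
    · rintro (rfl | rfl)
      · exact ⟨hX.out hB hA ⟨covBy_a.le, hC₀A.le⟩, covBy_a, hC₀A⟩
      · exact ⟨hX.out hB hA ⟨covBy_b.le, covBy_ab.le⟩, covBy_b, covBy_ab⟩
  have hne : insert a B ≠ insert b B := fun h =>
    hb (h ▸ mem_insert_self b B)
  rw [filter_eq, card_pair hne]
  exact even_two

theorem boundary_mul_boundary {X : Finset (Finset α)}
    (hX : (X : Set (Finset α)).OrdConnected) : boundary X * boundary X = 0 := by
  classical
  ext B A
  simp only [mul_apply, boundary, of_apply, ite_zero_mul_ite_zero, mul_one]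
  rw [sum_coe_sort X fun C => if (B : Finset α) ⋖ C ∧ C ⋖ A then (1 : ZMod 2) else 0, sum_boole,
    Matrix.zero_apply, ZMod.natCast_eq_zero_iff_even]
  exact even_card_covBy_covBy hX A.2 B.2

variable [DecidableEq α]

theorem hasContraction_boundary_of_filter_mem {X : Finset (Finset α)}
    (hX : (X : Set (Finset α)).OrdConnected) (i : α)
    (hmem : HasContraction (boundary {A ∈ X | i ∈ A}))
    (hnotMem : HasContraction (boundary {A ∈ X | i ∉ A})) : HasContraction (boundary X) := by
  have hunion : {A ∈ X | i ∈ A} ∪ {A ∈ X | i ∉ A} = X := filter_union_filter_not_eq _ X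
  rw [← hunion]
  refine hasContraction_boundary_union (fun B hB A hA hBA => ?_) ?_ hmem hnotMem
  · exact (mem_filter.1 hA).2 (hBA (mem_filter.1 hB).2)
  · rw [hunion]
    exact boundary_mul_boundary hX

theorem filter_mem_Icc (P Q : Finset α) (i : α) :
    {A ∈ Icc P Q | i ∈ A} = Icc (insert i P) Q := by
  ext A
  simp only [mem_filter, mem_Icc, insert_subset_iff]
  tauto

theorem filter_notMem_Icc (P Q : Finset α) (i : α) :
    {A ∈ Icc P Q | i ∉ A} = Icc P (Q.erase i) := by
  ext A
  simp only [mem_filter, mem_Icc, subset_erase, and_assoc]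

theorem hasContraction_boundary_Icc {P Q : Finset α} (hPQ : P ⊂ Q) :
    HasContraction (boundary (Icc P Q)) := by
  by_cases hcov : P ⋖ Q
  · have : Icc P Q = {P, Q} := by
      rw [← coe_inj, coe_Icc, hcov.Icc_eq, coe_pair]
    rw [this]
    exact hasContraction_boundary_pair hcov
  obtain ⟨i, hiQ, hiP⟩ := exists_of_ssubset hPQ
  have hinsert : insert i P ⊂ Q :=
    (insert_subset hiQ hPQ.subset).ssubset_of_ne fun h => hcov (h ▸ covBy_insert hiP)
  have herase : P ⊂ Q.erase i :=
    (subset_erase.2 ⟨hPQ.subset, hiP⟩).ssubset_of_ne fun h =>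
      hcov (h ▸ erase_covBy hiQ)
  refine hasContraction_boundary_of_filter_mem (by simpa using Set.ordConnected_Icc) i ?_ ?_
  · rw [filter_mem_Icc]
    exact hasContraction_boundary_Icc hinsert
  · rw [filter_notMem_Icc]
    exact hasContraction_boundary_Icc herase
termination_by #(Q \ P)
decreasing_by
  · rw [sdiff_insert]
    exact card_erase_lt_of_mem (mem_sdiff.2 ⟨hiQ, hiP⟩)
  · rw [erase_sdiff_comm]
    exact card_erase_lt_of_mem (mem_sdiff.2 ⟨hiQ, hiP⟩)

end SetFamilies

section DecisionTrees

variable {n : ℕ}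

theorem DecisionTree.ReadOnce.depth_le_card_vars {T : DecisionTree n} (hT : T.ReadOnce) :
    T.depth ≤ #T.vars := by
  induction T with
  | leaf b => exact Nat.zero_le _
  | node i l r ihl ihr =>
    obtain ⟨hil, hir, hl, hr⟩ := hT
    rw [vars, card_insert_of_notMem (notMem_union.2 ⟨hil, hir⟩)]
    exact Nat.succ_le_succ (max_le ((ihl hl).trans (card_le_card subset_union_left))
      ((ihr hr).trans (card_le_card subset_union_right)))

theorem exists_readOnce_eval_eq_inter (S : Finset (Fin n)) (f : BoolFun n) :
    ∃ T : DecisionTree n, T.ReadOnce ∧ T.vars ⊆ S ∧ ∀ x, T.eval x = f (x ∩ S) := by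
  induction S using Finset.induction_on generalizing f with
  | empty => exact ⟨.leaf (f ∅), trivial, empty_subset _, fun x => by rw [inter_empty]; rfl⟩
  | insert i S hi ih =>
    obtain ⟨l, hl, hlS, hleval⟩ := ih fun x => f (insert i x)
    obtain ⟨r, hr, hrS, hreval⟩ := ih f
    refine ⟨.node i l r, ⟨fun h => hi (hlS h), fun h => hi (hrS h), hl, hr⟩,
      insert_subset_insert i (union_subset hlS hrS), fun x => ?_⟩
    by_cases hx : i ∈ x
    · rw [DecisionTree.eval, if_pos hx, hleval, inter_insert_of_mem hx]
    · rw [DecisionTree.eval, if_neg hx, hreval, inter_insert_of_notMem hx]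

theorem exists_isTreeOf (f : BoolFun n) : ∃ T : DecisionTree n, T.IsTreeOf f := by
  obtain ⟨T, hT, -, heval⟩ := exists_readOnce_eval_eq_inter univ f
  exact ⟨T, hT, fun x => by rw [heval, inter_univ]⟩

theorem exists_isTreeOf_depth_eq_D (f : BoolFun n) :
    ∃ T : DecisionTree n, T.IsTreeOf f ∧ T.depth = D f :=
  Nat.sInf_mem (s := {d | ∃ T : DecisionTree n, T.IsTreeOf f ∧ T.depth = d})
    ((exists_isTreeOf f).imp' DecisionTree.depth fun T hT => ⟨T, hT, rfl⟩)

theorem exists_isTreeOf_depth_lt_of_not_isElusive {f : BoolFun n} (hf : ¬ IsElusive f) :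
    ∃ T : DecisionTree n, T.IsTreeOf f ∧ T.depth < n := by
  obtain ⟨T, hT, hdepth⟩ := exists_isTreeOf_depth_eq_D f
  have hle : T.depth ≤ n := hT.1.depth_le_card_vars.trans (card_finset_fin_le _)
  exact ⟨T, hT, hle.lt_of_ne (hdepth ▸ hf)⟩

theorem MonotoneNonincreasing.ordConnected_filter_Icc {f : BoolFun n}
    (hf : MonotoneNonincreasing f) (P Q : Finset (Fin n)) :
    (↑{A ∈ Icc P Q | f A = true} : Set (Finset (Fin n))).OrdConnected := by
  have hlower : IsLowerSet {A | f A = true} := fun A B hBA hA => hf A B hBA hA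
  have hcoe : (↑{A ∈ Icc P Q | f A = true} : Set (Finset (Fin n))) =
      Set.Icc P Q ∩ {A | f A = true} := by
    ext A
    simp
  rw [hcoe]
  exact Set.ordConnected_Icc.inter hlower.ordConnected

theorem hasContraction_of_eval_eq {f : BoolFun n} (hf : MonotoneNonincreasing f)
    (T : DecisionTree n) {P Q : Finset (Fin n)} (hdepth : T.depth + #P < #Q)
    (heval : ∀ A ∈ Icc P Q, T.eval A = f A) :
    HasContraction (boundary {A ∈ Icc P Q | f A = true}) := by
  induction T generalizing P Q with
  | leaf b =>
    by_cases hX : b = true ∧ P ⊆ Q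
    · obtain ⟨rfl, hPQ⟩ := hX
      have htrue : {A ∈ Icc P Q | f A = true} = Icc P Q :=
        filter_true_of_mem fun A hA => (heval A hA).symm
      rw [htrue]
      refine hasContraction_boundary_Icc (hPQ.ssubset_of_ne ?_)
      rintro rfl
      omega
    · have hempty : {A ∈ Icc P Q | f A = true} = ∅ :=
        filter_false_of_mem fun A hA hfA => hX
          ⟨(heval A hA).trans hfA, nonempty_Icc.1 ⟨A, hA⟩⟩
      rw [hempty]
      exact hasContraction_of_isEmpty _
  | node i l r ihl ihr =>
    rw [DecisionTree.depth] at hdepth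
    have hcardP := card_insert_le i P
    have hcardQ := Q.pred_card_le_card_erase (a := i)
    refine hasContraction_boundary_of_filter_mem (hf.ordConnected_filter_Icc P Q) i ?_ ?_
    · rw [filter_comm, filter_mem_Icc]
      refine ihl (by omega) fun A hA => ?_
      rw [← filter_mem_Icc, mem_filter] at hA
      rw [← heval A hA.1, DecisionTree.eval, if_pos hA.2]
    · rw [filter_comm, filter_notMem_Icc]
      refine ihr (by omega) fun A hA => ?_
      rw [← filter_notMem_Icc, mem_filter] at hA
      rw [← heval A hA.1, DecisionTree.eval, if_neg hA.2]

theorem even_card_fixed_true_of_not_isElusive {f : BoolFun n} (hf : MonotoneNonincreasing f)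
    (hne : ¬ IsElusive f) (σ : Equiv.Perm (Fin n)) (hσ : ∀ A, f (A.map σ.toEmbedding) = f A) :
    Even #{A : Finset (Fin n) | f A = true ∧ A.map σ.toEmbedding = A} := by
  obtain ⟨T, hT, hdepth⟩ := exists_isTreeOf_depth_lt_of_not_isElusive hne
  have hcon : HasContraction (boundary {A ∈ Icc ∅ univ | f A = true}) :=
    hasContraction_of_eval_eq hf T (by simpa using hdepth) fun A _ => hT.2 A
  have hIcc : Icc (∅ : Finset (Fin n)) univ = univ := Icc_bot_top
  rw [hIcc] at hcon
  let τ : Finset (Fin n) ≃o Finset (Fin n) :=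
    σ.finsetCongr.toOrderIso (fun _ _ h => map_subset_map.2 h) (fun _ _ h => map_subset_map.2 h)
  have hτ : ∀ A, f (τ A) = f A := hσ
  rw [← filter_filter]
  exact even_card_fixed_of_hasContraction hcon τ fun A => by simp only [mem_filter_univ, hτ]

theorem Nontrivial.apply_empty {f : BoolFun n} (hnt : Nontrivial f)
    (hf : MonotoneNonincreasing f) : f ∅ = true := by
  by_contra h
  exact hnt ⟨false, fun x => Bool.eq_false_iff.2 fun hx => h (hf x ∅ (empty_subset x) hx)⟩

theorem Nontrivial.apply_univ {f : BoolFun n} (hnt : Nontrivial f)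
    (hf : MonotoneNonincreasing f) : f univ = false :=
  Bool.eq_false_iff.2 fun h => hnt ⟨true, fun x => hf univ x (subset_univ x) h⟩

end DecisionTrees

theorem eq_empty_or_eq_univ_of_map_eq {α : Type*} [Fintype α] {σ : Equiv.Perm α}
    (hσ : σ.IsCycleOn Set.univ) {A : Finset α} (hA : A.map σ.toEmbedding = A) :
    A = ∅ ∨ A = univ := by
  refine A.eq_empty_or_nonempty.imp_right fun ⟨a, ha⟩ => eq_univ_of_forall fun x => ?_
  have hmaps : Set.MapsTo σ A A := fun y hy => mem_coe.2 (hA ▸ mem_map_of_mem σ.toEmbedding hy)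
  rw [← coe_univ] at hσ
  obtain ⟨k, -, rfl⟩ := hσ.exists_pow_eq (mem_univ a) (mem_univ x)
  rw [← Equiv.Perm.iterate_eq_pow]
  exact hmaps.iterate k ha

theorem isCycleOn_univ_finRotate {n : ℕ} (hn : 2 ≤ n) : (finRotate n).IsCycleOn Set.univ := by
  have := (isCycle_finRotate_of_le hn).isCycleOn
  rwa [← Equiv.Perm.coe_support_eq_set_support, support_finRotate_of_le hn, coe_univ] at this

end Elusive

theorem mainTheorem6_general {n : ℕ} {G : Subgroup (Equiv.Perm (Fin n))} {σ : Equiv.Perm (Fin n)}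
    (hσG : σ ∈ G) (hσ : σ.IsCycleOn Set.univ) (f : Elusive.BoolFun n)
    (hnontrivial : Elusive.Nontrivial f)
    (hmono : Elusive.MonotoneNonincreasing f)
    (hinv : Elusive.IsInvariant G f) :
    Elusive.IsElusive f := by
  by_contra hne
  have heven := Elusive.even_card_fixed_true_of_not_isElusive hmono hne σ
    fun A => (hinv σ hσG A).symm
  have hfixed : ({A | f A = true ∧ A.map σ.toEmbedding = A} : Finset (Finset (Fin n))) = {∅} := by
    ext A
    simp only [Finset.mem_filter, Finset.mem_univ, true_and, Finset.mem_singleton]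
    constructor
    · rintro ⟨hfA, hA⟩
      refine (Elusive.eq_empty_or_eq_univ_of_map_eq hσ hA).resolve_right ?_
      rintro rfl
      simp [hnontrivial.apply_univ hmono] at hfA
    · rintro rfl
      exact ⟨hnontrivial.apply_empty hmono, Finset.map_empty _⟩
  rw [hfixed, Finset.card_singleton] at heven
  exact Nat.not_even_one heven

theorem mainTheorem6 (f : Elusive.BoolFun 14)
    (hnontrivial : Elusive.Nontrivial f)
    (hmono : Elusive.MonotoneNonincreasing f)
    (hinv : Elusive.IsInvariant Elusive.G₁ f) :
    Elusive.IsElusive f :=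
  mainTheorem6_general (Subgroup.mem_zpowers _) (Elusive.isCycleOn_univ_finRotate (by norm_num)) f
    hnontrivial hmono hinv
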